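/- Let $\mathbb K=\mathbb R$ or $\mathbb C$, let $G\subset\mathbb K^n$ be a domain (nonempty connected open set), and let $X$ be an $n\times m$ matrix whose entries are holomorphic functions $G\to\mathbb K$ (real analytic if $\mathbb K=\mathbb R$). Suppose that the autonomous total differential system $$dx = X(x)\,dt,\qquad t\in\mathbb K^m,\ x\in G,\tag{ATD}$$ is completely solvable: for every $(t_0,x_0)\in\mathbb K^m\times G$ the Cauchy problem $x(t_0)=x_0$ has a solution on some domain $T\ni t_0$ of $\mathbb K^m$, and any two solutions of it on the same domain coincide. An autonomous first integral of (ATD) on a domain $U\subset G$ is a holomorphic function $F:U\to\mathbb K$ with $dF(x)\,X(x)=0$ for all $x\in U$. Functions $F_1,\dots,F_k$ on $U$ are functionally independent on $U$ if their Jacobi matrix has rank $k$ at every point of $U$ outside a set of measure zero. 1. Let $G'\subset G$ be a domain on which $\operatorname{rank}X(x)=r$ is constant. Then (ATD) has locally on $G'$ exactly $n-r$ functionally independent autonomous first integrals: every point of $G'$ has a neighbourhood $U\subset G'$ that is a domain and on which there are $n-r$ functionally independent autonomous first integrals, and on no domain $U\subset G'$ are there more than $n-r$ of them. 2. (ATD)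 has no autonomous first integrals, that is, every autonomous first integral on any domain $U\subset G$ is constant, if and only if $\operatorname{rank}X(x)=n$ for all $x\in G$ outside a set of ($n$-dimensional Lebesgue) measure zero. -/

import Mathlib

open MeasureTheory

namespace TotalDiff

/-- A domain: a nonempty connected open set. -/
def IsDomainSet {E : Type*} [TopologicalSpace E] (U : Set E) : Prop :=
  IsOpen U ∧ IsConnected U

section TD

variable {𝕜 : Type*} [RCLike 𝕜] {m n : ℕ}

/-- `x : T → 𝕜ⁿ` is a solution on the domain `T ⊆ 𝕜ᵐ` of the total differential system
`dx = X(t,x) dt`, whose right-hand side is considered on `D ⊆ 𝕜ᵐ × 𝕜ⁿ`: the graph of `x` stays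
in `D`, and `x` is differentiable on `T` with Jacobi matrix `X(t, x(t))`. -/
def IsSolutionOn (X : (Fin m → 𝕜) × (Fin n → 𝕜) → Matrix (Fin n) (Fin m) 𝕜)
    (D : Set ((Fin m → 𝕜) × (Fin n → 𝕜))) (T : Set (Fin m → 𝕜))
    (x : (Fin m → 𝕜) → (Fin n → 𝕜)) : Prop :=
  IsDomainSet T ∧ ∀ t ∈ T, (t, x t) ∈ D ∧
    HasFDerivAt x (LinearMap.toContinuousLinearMap (Matrix.toLin' (X (t, x t)))) t

/-- The system `dx = X(t,x) dt` is completely solvable on `D`: for every `(t₀, x₀) ∈ D` the Cauchy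
problem `x(t₀) = x₀` has a solution on some domain containing `t₀`, and two solutions of this
Cauchy problem that are defined on the same domain coincide there. -/
def CompletelySolvable (X : (Fin m → 𝕜) × (Fin n → 𝕜) → Matrix (Fin n) (Fin m) 𝕜)
    (D : Set ((Fin m → 𝕜) × (Fin n → 𝕜))) : Prop :=
  ∀ t₀ x₀, (t₀, x₀) ∈ D →
    (∃ T x, t₀ ∈ T ∧ IsSolutionOn X D T x ∧ x t₀ = x₀) ∧
    ∀ T x y, t₀ ∈ T → IsSolutionOn X D T x → IsSolutionOn X D T y →
      x t₀ = x₀ → y t₀ = x₀ → Set.EqOn x y T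

/-- `F` is a first integral of `dx = X(t,x) dt` on `D`: it is holomorphic (analytic) on `D`, and
its differential by virtue of the system, that is, after the substitution `dx = X(t,x) dt`,
vanishes identically on `D`. -/
def IsFirstIntegralOn (X : (Fin m → 𝕜) × (Fin n → 𝕜) → Matrix (Fin n) (Fin m) 𝕜)
    (D : Set ((Fin m → 𝕜) × (Fin n → 𝕜))) (F : (Fin m → 𝕜) × (Fin n → 𝕜) → 𝕜) : Prop :=
  AnalyticOnNhd 𝕜 F D ∧
    ∀ p ∈ D, ∀ dt : Fin m → 𝕜, fderiv 𝕜 F p (dt, (X p).mulVec dt) = 0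

/-- The right-hand side of the autonomous system `dx = X(x) dt`, as a function of `(t, x)`. -/
def autonomous (X : (Fin n → 𝕜) → Matrix (Fin n) (Fin m) 𝕜) :
    (Fin m → 𝕜) × (Fin n → 𝕜) → Matrix (Fin n) (Fin m) 𝕜 :=
  fun p => X p.2

/-- `F : U → 𝕜` is an autonomous first integral on `U ⊆ 𝕜ⁿ` of the autonomous system
`dx = X(x) dt`: the function `(t, x) ↦ F x` is a first integral on `𝕜ᵐ × U`. -/
def IsAutonomousFirstIntegralOn (X : (Fin n → 𝕜) → Matrix (Fin n) (Fin m) 𝕜)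
    (U : Set (Fin n → 𝕜)) (F : (Fin n → 𝕜) → 𝕜) : Prop :=
  IsFirstIntegralOn (autonomous X) (Set.univ ×ˢ U) fun p => F p.2

/-- A property holds for all points of `U ⊆ 𝕜ⁿ` except for a set of measure zero (with respect to
Haar measure of `𝕜ⁿ`, that is, Lebesgue measure up to a positive factor). -/
def AlmostEverywhereOn (U : Set (Fin n → 𝕜)) (P : (Fin n → 𝕜) → Prop) : Prop :=
  (Measure.addHaar : Measure (Fin n → 𝕜)) {x ∈ U | ¬ P x} = 0

/-- The Jacobi matrix of `F₁, …, F_k` at `x`. -/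
noncomputable def jacobiMatrix {k : ℕ} (F : Fin k → (Fin n → 𝕜) → 𝕜) (x : Fin n → 𝕜) :
    Matrix (Fin k) (Fin n) 𝕜 :=
  Matrix.of fun l i => fderiv 𝕜 (F l) x (Pi.single i 1)

/-- `F₁, …, F_k` are functionally independent on `U`: their Jacobi matrix has rank `k` at almost
every point of `U`. -/
def FunctionallyIndependentOn {k : ℕ} (U : Set (Fin n → 𝕜)) (F : Fin k → (Fin n → 𝕜) → 𝕜) :
    Prop :=
  AlmostEverywhereOn U fun x => (jacobiMatrix F x).rank = k

end TD

end TotalDiff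

/-!
The system `dx = X(x) dt` is read as the total differential equation `dy = A(y) dt`, where `A x` is
the linear map of the matrix `X x`.

*The flow is analytic.* The solutions provided by complete solvability are not assumed to depend on
the initial value in any regular way. Along a ray `s ↦ s t` such a solution solves the integral
equation `u = x + ∫ A(u) t` in the Banach space of curves `[0, 1] → 𝕜ⁿ`. The superposition operator
`u ↦ A ∘ u` is analytic there (`AnalyticAt.exists_analyticAt_superposition`), and for `t = 0` the
equation is trivial, so that the analytic inverse function theorem yields one function `φ (x, t)`,
analytic near `(c, 0)`, which agrees with every solution for small `t`
(`AnalyticAt.exists_analyticAt_flow`). How small may depend on `x`, but by the identity theorem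
`∂φ/∂t = A(φ)` holds on a full neighbourhood of `(c, 0)` (`AnalyticAt.exists_local_flow`). This
works over `ℝ` and `ℂ` alike, and the commutation relations of the columns of `X` are not needed.

*First integrals.* Let `V` be a complement of the kernel and `W` one of the range of `A c`. Then
`(τ, w) ↦ φ (c + w, τ)` is an analytic local diffeomorphism from `V × W` to `𝕜ⁿ`; the `W`-component
of its inverse is constant along the flow in the directions of `V` and has a surjective differential
(`AnalyticAt.exists_transversal_integrals`). If the rank is constant, `A x` maps `V` onto the whole
range of `A x`, so that the components are first integrals. There cannot be more independent ones,
because the Jacobi matrix annihilates `X`.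

*Rank and constants.* Where the rank is `n`, the differential of a first integral vanishes; if this
is almost everywhere, then by continuity it vanishes everywhere. Conversely, if `X y` has
the right inverse `B`, then `det (X x * B)` is an analytic function of `x` that is nonzero at `y`,
hence nonzero almost everywhere (`AnalyticOnNhd.measure_zeros`). So if the rank is not `n` almost
everywhere, then it is less than `n` everywhere; near a point of maximal rank it is constant, and
nonconstant first integrals exist by the first part.
-/

/-! ### Superposition operators -/

section Superposition
open scoped Topology ENNReal NNReal

theorem ContinuousMap.update_eval {ι α E : Type*} [DecidableEq ι] [TopologicalSpace α]
    [TopologicalSpace E] (u : ι → C(α, E)) (i : ι)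
    (z : C(α, E)) (s : α) :
    (fun j => Function.update u i z j s) = Function.update (fun j => u j s) i (z s) := by
  ext j
  by_cases hj : j = i
  · subst hj; simp
  · simp [hj]

variable {𝕜 α E F : Type*} [NontriviallyNormedField 𝕜] [TopologicalSpace α] [CompactSpace α]
  [NormedAddCommGroup E] [NormedSpace 𝕜 E] [NormedAddCommGroup F] [NormedSpace 𝕜 F]

/-- A continuous multilinear map applied pointwise to continuous functions on a compact space. -/
noncomputable def ContinuousMultilinearMap.pointwise {k : ℕ} (p : E [×k]→L[𝕜] F) :
    C(α, E) [×k]→L[𝕜] C(α, F) :=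
  MultilinearMap.mkContinuous
    { toFun := fun u => ⟨fun s => p fun i => u i s, by fun_prop⟩
      map_update_add' := by
        intro _ u i x y
        ext s
        simp [ContinuousMap.update_eval]
      map_update_smul' := by
        intro _ u i a x
        ext s
        simp [ContinuousMap.update_eval] }
    ‖p‖ (by
      intro u
      refine (ContinuousMap.norm_le _ (by positivity)).2 fun s => ?_
      refine (p.le_opNorm _).trans ?_
      gcongr with i
      exact (u i).norm_coe_le_norm s)

theorem ContinuousMultilinearMap.norm_pointwise_le {k : ℕ} (p : E [×k]→L[𝕜] F) :
    ‖(p.pointwise : C(α, E) [×k]→L[𝕜] C(α, F))‖ ≤ ‖p‖ :=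
  MultilinearMap.mkContinuous_norm_le _ (norm_nonneg _) _

/-- Composition with an analytic map is an analytic operation on continuous functions on a compact
space: its power series is obtained by applying that of the map pointwise. -/
theorem AnalyticAt.exists_analyticAt_superposition [CompleteSpace F] {f : E → F} {c : E}
    (hf : AnalyticAt 𝕜 f c) :
    ∃ N : C(α, E) → C(α, F), AnalyticAt 𝕜 N (ContinuousMap.const α c) ∧
      ∀ᶠ u in 𝓝 (ContinuousMap.const α c), ∀ s, N u s = f (u s) := by
  obtain ⟨p, r, hp⟩ := hf
  let P : FormalMultilinearSeries 𝕜 C(α, E) C(α, F) := fun k => (p k).pointwise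
  have hrad : p.radius ≤ P.radius :=
    FormalMultilinearSeries.radius_le_of_le fun k => (p k).norm_pointwise_le
  have hrP : r ≤ P.radius := hp.r_le.trans hrad
  have hP := P.hasFPowerSeriesOnBall (hp.r_pos.trans_le hrP)
  refine ⟨fun u => P.sum (u - ContinuousMap.const α c), ?_, ?_⟩
  · have hg : AnalyticAt 𝕜 (fun u : C(α, E) => u - ContinuousMap.const α c)
        (ContinuousMap.const α c) := analyticAt_id.fun_sub analyticAt_const
    refine AnalyticAt.fun_comp (g := P.sum) ?_ hg
    simpa using hP.analyticAt
  · filter_upwards [Metric.eball_mem_nhds (ContinuousMap.const α c) hp.r_pos] with u hu s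
    have hu' : edist u (ContinuousMap.const α c) < r := hu
    have hmem : u - ContinuousMap.const α c ∈ Metric.eball (0 : C(α, E)) P.radius := by
      rw [Metric.mem_eball, edist_zero_right, ← edist_eq_enorm_sub]
      exact hu'.trans_le hrP
    have h1 := (hP.hasSum hmem).map
      (ContinuousMap.evalCLM 𝕜 s : C(α, F) →L[𝕜] F) (ContinuousLinearMap.continuous _)
    have hs : u s - c ∈ Metric.eball (0 : E) r := by
      rw [Metric.mem_eball, edist_zero_right, ← edist_eq_enorm_sub]
      refine lt_of_le_of_lt ?_ hu'
      rw [edist_dist, edist_dist]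
      exact ENNReal.ofReal_le_ofReal (ContinuousMap.dist_apply_le_dist (f := u)
        (g := ContinuousMap.const α c) s)
    have h2 := hp.hasSum hs
    rw [add_sub_cancel] at h2
    rw [zero_add] at h1
    exact HasSum.unique h1 h2

end Superposition

/-! ### Analytic dependence on initial values -/

section Flow
open scoped Topology ContDiff unitInterval

/-- Integration of continuous functions on `[0, 1]`: it takes `v` to `s ↦ ∫₀ˢ v`. -/
noncomputable def volterra (𝕜 : Type*) [RCLike 𝕜] (E : Type*) [NormedAddCommGroup E]
    [NormedSpace 𝕜 E] [NormedSpace ℝ E] [IsScalarTower ℝ 𝕜 E] : C(I, E) →L[𝕜] C(I, E) :=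
  LinearMap.mkContinuous
    { toFun := fun v => ⟨fun s => ∫ τ in (0 : ℝ)..s, Set.IccExtend zero_le_one v τ,
        (intervalIntegral.continuous_primitive (fun _ _ =>
          (v.continuous.Icc_extend' (h := zero_le_one)).intervalIntegrable _ _) 0).comp
          continuous_subtype_val⟩
      map_add' := fun v w => by
        ext s
        exact intervalIntegral.integral_add
          ((v.continuous.Icc_extend' (h := zero_le_one)).intervalIntegrable _ _)
          ((w.continuous.Icc_extend' (h := zero_le_one)).intervalIntegrable _ _)
      map_smul' := fun a v => by
        ext s
        exact intervalIntegral.integral_smul a _ }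
    1 (by
      intro v
      refine (ContinuousMap.norm_le _ (by positivity)).2 fun s => ?_
      refine (intervalIntegral.norm_integral_le_of_norm_le_const
        (C := ‖v‖) fun τ _ => v.norm_coe_le_norm _).trans ?_
      rw [sub_zero, abs_of_nonneg s.2.1, one_mul]
      exact mul_le_of_le_one_right (norm_nonneg _) s.2.2)

theorem volterra_apply (𝕜 : Type*) [RCLike 𝕜] {E : Type*} [NormedAddCommGroup E]
    [NormedSpace 𝕜 E] [NormedSpace ℝ E] [IsScalarTower ℝ 𝕜 E] (v : C(I, E)) (s : I) :
    volterra 𝕜 E v s = ∫ τ in (0 : ℝ)..s, Set.IccExtend zero_le_one v τ := rfl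

/-- Pointwise application of a continuous family of operators to a fixed vector. -/
noncomputable def pointwiseApply (𝕜 α M E : Type*) [NontriviallyNormedField 𝕜] [TopologicalSpace α]
    [CompactSpace α] [NormedAddCommGroup M] [NormedSpace 𝕜 M] [NormedAddCommGroup E]
    [NormedSpace 𝕜 E] : C(α, M →L[𝕜] E) →L[𝕜] M →L[𝕜] C(α, E) :=
  LinearMap.mkContinuous₂
    (LinearMap.mk₂ 𝕜 (fun (a : C(α, M →L[𝕜] E)) (t : M) => (⟨fun s => a s t, by fun_prop⟩ : C(α, E)))
      (fun _ _ _ => rfl) (fun _ _ _ => rfl)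
      (fun a t t' => by ext s; exact map_add (a s) t t')
      (fun k a t => by ext s; exact map_smul (a s) k t)) 1
    (by
      intro a t
      rw [one_mul]
      refine (ContinuousMap.norm_le _ (by positivity)).2 fun s => ?_
      exact (a s).le_of_opNorm_le (a.norm_coe_le_norm s) t)

@[simp] theorem pointwiseApply_apply {𝕜 α M E : Type*} [NontriviallyNormedField 𝕜]
    [TopologicalSpace α]
    [CompactSpace α] [NormedAddCommGroup M] [NormedSpace 𝕜 M] [NormedAddCommGroup E]
    [NormedSpace 𝕜 E] (a : C(α, M →L[𝕜] E)) (t : M) (s : α) :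
    pointwiseApply 𝕜 α M E a t s = a s t := rfl

variable {𝕜 : Type*} [RCLike 𝕜]
  {E : Type*} [NormedAddCommGroup E] [NormedSpace 𝕜 E] [NormedSpace ℝ E] [IsScalarTower ℝ 𝕜 E]
  [CompleteSpace E]
  {M : Type*} [NormedAddCommGroup M] [NormedSpace 𝕜 M] [NormedSpace ℝ M] [IsScalarTower ℝ 𝕜 M]

/-- Along a ray, a solution of the total differential equation `dy = A(y) dt` satisfies the
integral equation of the corresponding ordinary differential equation. -/
theorem eq_add_volterra_of_hasFDerivAt {A : E → M →L[𝕜] E} {y : M → E} {t : M}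
    (hy : ∀ s : I, HasFDerivAt y (A (y ((s : ℝ) • t))) ((s : ℝ) • t))
    {u : C(I, E)} (hu : ∀ s : I, u s = y ((s : ℝ) • t))
    {a : C(I, M →L[𝕜] E)} (ha : ∀ s : I, a s = A (u s)) :
    u = ContinuousMap.const I (y 0) + volterra 𝕜 E (pointwiseApply 𝕜 I M E a t) := by
  ext s
  have hcont := (pointwiseApply 𝕜 I M E a t).continuous.Icc_extend' (h := zero_le_one)
  have h := intervalIntegral.integral_eq_sub_of_hasDerivAt (a := 0) (b := (s : ℝ))
    (f := fun τ : ℝ => y (τ • t)) (f' := Set.IccExtend zero_le_one (pointwiseApply 𝕜 I M E a t))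
    ?_ (hcont.intervalIntegrable _ _)
  · rw [ContinuousMap.add_apply, volterra_apply, h, hu]
    simp
  · intro τ hτ
    rw [Set.uIcc_of_le s.2.1] at hτ
    have hτ' : τ ∈ I := ⟨hτ.1, hτ.2.trans s.2.2⟩
    rw [Set.IccExtend_of_mem _ _ hτ', pointwiseApply_apply, ha, hu]
    have h1 : HasDerivAt (fun τ : ℝ => τ • t) t τ := by
      simpa using (hasDerivAt_id τ).smul_const t
    exact ((hy ⟨τ, hτ'⟩).restrictScalars ℝ).comp_hasDerivAt τ h1

/-- An analytic family of fixed-point equations `u = ι x + K (N u) t` with parameters `x`, `t` is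
uniquely solvable near its solution `u = ι c` for `x = c`, `t = 0`, and the solution is analytic in
the parameters. -/
theorem exists_analyticAt_solution {E M C B : Type*} [NormedAddCommGroup E] [NormedSpace 𝕜 E]
    [CompleteSpace E] [NormedAddCommGroup M] [NormedSpace 𝕜 M] [CompleteSpace M]
    [NormedAddCommGroup C] [NormedSpace 𝕜 C] [CompleteSpace C]
    [NormedAddCommGroup B] [NormedSpace 𝕜 B]
    (ι : E →L[𝕜] C) (K : B →L[𝕜] M →L[𝕜] C) {N : C → B} {c : E} (hN : AnalyticAt 𝕜 N (ι c)) :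
    ∃ S : E × M → C, AnalyticAt 𝕜 S (c, 0) ∧ ∀ᶠ p : E × M × C in 𝓝 (c, 0, ι c),
      p.2.2 = ι p.1 + K (N p.2.2) p.2.1 → p.2.2 = S (p.1, p.2.1) := by
  let H : E × M × C → E × M × C := fun p => (p.1, p.2.1, p.2.2 - ι p.1 - K (N p.2.2) p.2.1)
  let p₀ : E × M × C := (c, 0, ι c)
  have hKN : AnalyticAt 𝕜 (fun p : E × M × C => K (N p.2.2)) p₀ :=
    (K.analyticAt _).comp (AnalyticAt.fun_comp (g := N) (f := fun p : E × M × C => p.2.2)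
      (x := p₀) hN (analyticAt_snd.comp analyticAt_snd))
  have hH : AnalyticAt 𝕜 H p₀ := by
    have h1 : AnalyticAt 𝕜 (fun p : E × M × C => p.2.1) p₀ :=
      analyticAt_fst.comp analyticAt_snd
    have h2 : AnalyticAt 𝕜 (fun p : E × M × C => p.2.2) p₀ :=
      analyticAt_snd.comp analyticAt_snd
    have h3 : AnalyticAt 𝕜 (fun p : E × M × C => ι p.1) p₀ :=
      (ι.analyticAt _).comp analyticAt_fst
    have h4 : AnalyticAt 𝕜 (fun p : E × M × C => K (N p.2.2) p.2.1) p₀ :=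
      (hKN.contDiffAt.clm_apply h1.contDiffAt (n := ω)).analyticAt
    exact analyticAt_fst.prod (h1.prod ((h2.fun_sub h3).fun_sub h4))
  let L : E × M × C →L[𝕜] C :=
    ι.comp (ContinuousLinearMap.fst 𝕜 _ _) +
      (K (N (ι c))).comp ((ContinuousLinearMap.fst 𝕜 _ _).comp (ContinuousLinearMap.snd 𝕜 _ _))
  have hL : ∀ p, L p = ι p.1 + K (N (ι c)) p.2.1 := fun _ => rfl
  let D : (E × M × C) ≃L[𝕜] (E × M × C) :=
    ContinuousLinearEquiv.equivOfInverse
      (ContinuousLinearMap.id 𝕜 _ - (ContinuousLinearMap.inr 𝕜 _ _).comp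
        ((ContinuousLinearMap.inr 𝕜 _ _).comp L))
      (ContinuousLinearMap.id 𝕜 _ + (ContinuousLinearMap.inr 𝕜 _ _).comp
        ((ContinuousLinearMap.inr 𝕜 _ _).comp L))
      (by intro p; ext <;> simp [hL])
      (by intro p; ext <;> simp [hL])
  have hD : HasFDerivAt H (D : (E × M × C) →L[𝕜] (E × M × C)) p₀ := by
    have h1 : HasFDerivAt (fun p : E × M × C => p.2.1) _ p₀ :=
      (hasFDerivAt_snd (𝕜 := 𝕜) (p := p₀)).fst
    have h2 : HasFDerivAt (fun p : E × M × C => p.2.2) _ p₀ :=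
      (hasFDerivAt_snd (𝕜 := 𝕜) (p := p₀)).snd
    have h3 : HasFDerivAt (fun p : E × M × C => ι p.1) _ p₀ :=
      (ι.hasFDerivAt).comp p₀ hasFDerivAt_fst
    have h5 := hasFDerivAt_fst.prodMk (h1.prodMk ((h2.fun_sub h3).fun_sub
      (hKN.differentiableAt.hasFDerivAt.clm_apply h1)))
    refine h5.congr_fderiv ?_
    -- At `t = 0` the derivative of `u ↦ K (N u) t` vanishes.
    refine ContinuousLinearMap.ext fun p => Prod.ext ?_ (Prod.ext ?_ ?_) <;>
      simp [D, hL, p₀, sub_sub]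
  have hω : (ω : WithTop ℕ∞) ≠ 0 := by simp
  let R := hH.contDiffAt.toOpenPartialHomeomorph H (n := ω) hD hω
  have hHp₀ : H p₀ = (c, 0, 0) := by simp [H, p₀]
  have hp₀ : p₀ ∈ R.source := ContDiffAt.mem_toOpenPartialHomeomorph_source _ hD hω
  have hinv : AnalyticAt 𝕜 R.symm (c, 0, 0) := by
    rw [← hHp₀]
    exact (ContDiffAt.to_localInverse hH.contDiffAt hD hω).analyticAt
  refine ⟨fun q => (R.symm (q.1, q.2, 0)).2.2, ?_, ?_⟩
  · have hlin : AnalyticAt 𝕜 (fun q : E × M => ((q.1, q.2, 0) : E × M × C)) (c, 0) :=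
      analyticAt_fst.prod (analyticAt_snd.prod analyticAt_const)
    have h1 : AnalyticAt 𝕜 (fun q : E × M => R.symm (q.1, q.2, 0)) (c, 0) :=
      AnalyticAt.fun_comp (g := R.symm) hinv hlin
    exact analyticAt_snd.comp (analyticAt_snd.comp h1)
  · filter_upwards [R.open_source.mem_nhds hp₀] with p hp heq
    have hR : R p = (p.1, p.2.1, 0) := by
      change H p = _
      simp only [H]
      rw [Prod.mk.injEq, Prod.mk.injEq]
      exact ⟨rfl, rfl, by rw [sub_sub, sub_eq_zero]; exact heq⟩
    change p.2.2 = (R.symm (p.1, p.2.1, 0)).2.2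
    rw [← hR, R.left_inv hp]

/-- Analytic dependence on the initial value: near `c` the solutions of the total differential
equation `dy = A(y) dt`, as far as they exist, are given by one function `φ (x, t)` that is
analytic in the initial value `x` and in `t`. It comes from the integral equation
`u = x + ∫ A(u) t` for curves `u : [0, 1] → E`, whose solution is trivial for `t = 0`. -/
theorem AnalyticAt.exists_analyticAt_flow [CompleteSpace M] {A : E → M →L[𝕜] E} {c : E}
    (hA : AnalyticAt 𝕜 A c) :
    ∃ φ : E × M → E, AnalyticAt 𝕜 φ (c, 0) ∧ ∀ᶠ x in 𝓝 c, ∀ y : M → E, y 0 = x →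
      (∀ᶠ t in 𝓝 0, HasFDerivAt y (A (y t)) t) → ∀ᶠ t in 𝓝 0, y t = φ (x, t) := by
  obtain ⟨N, hN, hNA⟩ := hA.exists_analyticAt_superposition (α := I)
  obtain ⟨S, hS, hSu⟩ := exists_analyticAt_solution (𝕜 := 𝕜) (ContinuousLinearMap.const 𝕜 I)
    ((ContinuousLinearMap.compL 𝕜 M C(I, E) C(I, E) (volterra 𝕜 E)).comp
      (pointwiseApply 𝕜 I M E)) hN
  refine ⟨fun q => S q 1, ?_, ?_⟩
  · exact ((ContinuousMap.evalCLM 𝕜 (1 : I) : C(I, E) →L[𝕜] E).analyticAt _).comp hS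
  · obtain ⟨ε, hε, hball⟩ : ∃ ε > 0, ∀ x t u, dist x c < ε → dist t (0 : M) < ε →
        dist u (ContinuousMap.const I c) < ε →
        (u = ContinuousMap.const I x + volterra 𝕜 E (pointwiseApply 𝕜 I M E (N u) t) →
          u = S (x, t)) ∧ ∀ s, N u s = A (u s) := by
      have hNA' : ∀ᶠ p : E × M × C(I, E) in 𝓝 (c, 0, ContinuousMap.const I c),
          ∀ s, N p.2.2 s = A (p.2.2 s) :=
        ((continuous_snd.comp continuous_snd).tendsto
          ((c, 0, ContinuousMap.const I c) : E × M × C(I, E))).eventually hNA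
      obtain ⟨ε, hε, h⟩ := Metric.eventually_nhds_iff.1 (hSu.and hNA')
      exact ⟨ε, hε, fun x t u hx ht hu => h (y := (x, t, u)) (max_lt hx (max_lt ht hu))⟩
    filter_upwards [Metric.ball_mem_nhds c (half_pos hε)] with x hx y hy0 hy
    have hyc : ∀ᶠ t in 𝓝 0, dist (y t) x < ε / 2 := by
      have := hy.self_of_nhds.continuousAt
      rw [ContinuousAt, hy0] at this
      exact this.eventually (Metric.ball_mem_nhds x (half_pos hε))
    obtain ⟨δ, hδ, hδ'⟩ := Metric.eventually_nhds_iff.1 (hy.and hyc)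
    filter_upwards [Metric.ball_mem_nhds (0 : M) (lt_min hδ hε)] with t ht
    have ht' : dist t 0 < min δ ε := ht
    have hst : ∀ s : I, dist ((s : ℝ) • t) 0 < δ := by
      intro s
      rw [dist_zero_right, norm_smul, Real.norm_of_nonneg s.2.1]
      rw [dist_zero_right] at ht'
      exact (mul_le_of_le_one_left (norm_nonneg _) s.2.2).trans_lt (ht'.trans_le (min_le_left _ _))
    let u : C(I, E) := ⟨fun s => y ((s : ℝ) • t), continuous_iff_continuousAt.2 fun s =>
      ContinuousAt.comp (g := y) (f := fun s : I => (s : ℝ) • t) (hδ' (hst s)).1.continuousAt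
        (by fun_prop)⟩
    have hu : dist u (ContinuousMap.const I c) < ε := by
      refine (ContinuousMap.dist_lt_iff_of_nonempty).2 fun s => ?_
      have h1 := (hδ' (hst s)).2
      have h2 : dist x c < ε / 2 := hx
      calc dist (y ((s : ℝ) • t)) c ≤ dist (y ((s : ℝ) • t)) x + dist x c := dist_triangle _ _ _
        _ < ε := by linarith
    obtain ⟨hsol, hNu⟩ := hball x t u ((show dist x c < ε / 2 from hx).trans (half_lt_self hε))
      (ht'.trans_le (min_le_right _ _)) hu
    rw [show S (x, t) = u from (hsol ?_).symm]
    · simp [u]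
    · have hint := eq_add_volterra_of_hasFDerivAt (𝕜 := 𝕜) (A := A) (fun s => (hδ' (hst s)).1)
        (u := u) (fun _ => rfl) hNu
      rwa [hy0] at hint

end Flow

/-! ### Zero sets of analytic functions -/

section ZeroSet
open Set Topology

variable {E F : Type*} [NormedAddCommGroup E] [NormedSpace ℝ E] [FiniteDimensional ℝ E]
  [MeasurableSpace E] [BorelSpace E] [NormedAddCommGroup F] [NormedSpace ℝ F]

/-- On a ball about a point where an analytic function does not vanish, its zeros form a null set:
a line through the centre contains only countably many of them, so that by Tonelli almost all
dilates of the zero set are null. -/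
theorem AnalyticOnNhd.measure_zeros_ball (μ : Measure E) [μ.IsAddHaarMeasure] {f : E → F} {y : E}
    {ρ : ℝ} (hρ : 0 < ρ) (hf : AnalyticOnNhd ℝ f (Metric.ball y ρ)) (hy : f y ≠ 0) :
    μ {x ∈ Metric.ball y ρ | f x = 0} = 0 := by
  have hmeas : MeasurableSet {x ∈ Metric.ball y ρ | f x = 0} := by
    have h := hf.continuousOn.isOpen_inter_preimage Metric.isOpen_ball
      (isOpen_compl_singleton (x := (0 : F)))
    have h2 : {x ∈ Metric.ball y ρ | f x = 0}
        = Metric.ball y ρ \ (Metric.ball y ρ ∩ f ⁻¹' {0}ᶜ) := by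
      ext x; simp
    rw [h2]
    exact Metric.isOpen_ball.measurableSet.diff h.measurableSet
  rw [← measure_preimage_add μ y]
  set Z : Set E := (fun h => y + h) ⁻¹' {x ∈ Metric.ball y ρ | f x = 0} with hZ
  have hZm : MeasurableSet Z := (measurable_const_add y) hmeas
  let S : Set (E × ℝ) := (fun p : E × ℝ => p.2 • p.1) ⁻¹' Z
  have hS : MeasurableSet S := (measurable_snd.smul measurable_fst) hZm
  have hnull : (μ.prod volume) S = 0 := by
    rw [Measure.measure_prod_null hS]
    refine Filter.Eventually.of_forall fun v => ?_
    let γ : ℝ →ᵃ[ℝ] E := AffineMap.lineMap y (y + v)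
    have hγ : ∀ s, γ s = y + s • v := by
      intro s; simp [γ, AffineMap.lineMap_apply, add_comm]
    have hγc : Continuous γ := by
      have : (γ : ℝ → E) = fun s => y + s • v := funext hγ
      rw [this]; fun_prop
    let I : Set ℝ := γ ⁻¹' Metric.ball y ρ
    have hI : IsPreconnected I := ((convex_ball y ρ).affine_preimage γ).isPreconnected
    have hIo : IsOpen I := Metric.isOpen_ball.preimage hγc
    have h0 : (0 : ℝ) ∈ I := by simp [I, hγ, hρ]
    have hg : AnalyticOnNhd ℝ (fun s => f (γ s)) I := by
      intro s hs
      refine (hf (γ s) hs).fun_comp ?_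
      have : (γ : ℝ → E) = fun s => y + s • v := funext hγ
      rw [this]
      fun_prop
    rcases hg.eqOn_zero_or_eventually_ne_zero_of_preconnected hI with h | h
    · exact absurd (by simpa [hγ] using h h0) hy
    · have h2 := ae_restrict_le_codiscreteWithin (μ := volume) hIo.measurableSet h
      rw [mem_ae_iff, Measure.restrict_apply' hIo.measurableSet] at h2
      refine measure_mono_null ?_ h2
      intro s hs
      have hs' : y + s • v ∈ Metric.ball y ρ ∧ f (y + s • v) = 0 := hs
      rw [← hγ] at hs'
      exact ⟨fun h => h hs'.2, hs'.1⟩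
  have hswap : (volume.prod μ) (Prod.swap ⁻¹' S) = 0 := by
    rw [← Measure.prod_swap, Measure.map_apply measurable_swap (measurable_swap hS)]
    exact hnull
  rw [Measure.measure_prod_null (measurable_swap hS)] at hswap
  have hne : ∀ᵐ l : ℝ, l ≠ 0 := by
    rw [ae_iff]; simp
  obtain ⟨l, hl, hl0⟩ := (hswap.and hne).exists
  have h3 : μ ((fun x => l • x) ⁻¹' Z) = 0 := hl
  rw [Measure.addHaar_preimage_smul μ hl0, mul_eq_zero] at h3
  refine h3.resolve_left ?_
  simp [hl0]

/-- The zeros of an analytic function on a domain form a null set, unless it vanishes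
identically. -/
theorem AnalyticOnNhd.measure_zeros {𝕜 : Type*} [RCLike 𝕜] [NormedSpace 𝕜 E] [IsScalarTower ℝ 𝕜 E]
    [NormedSpace 𝕜 F] [IsScalarTower ℝ 𝕜 F]
    (μ : Measure E) [μ.IsAddHaarMeasure] {f : E → F} {G : Set E} (hG : IsOpen G)
    (hGc : IsPreconnected G) (hf : AnalyticOnNhd 𝕜 f G) {y : E} (hyG : y ∈ G) (hy : f y ≠ 0) :
    μ {x ∈ G | f x = 0} = 0 := by
  have : SecondCountableTopology E := by
    have := FiniteDimensional.proper ℝ E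
    infer_instance
  refine measure_null_of_locally_null _ fun x hx => ?_
  obtain ⟨ρ, hρ, hball⟩ := Metric.isOpen_iff.1 hG x hx.1
  -- A point of the half-size ball at which `f` does not vanish; the ball of radius `ρ / 2` about
  -- it contains `x` and lies in `G`.
  obtain ⟨z, hz, hfz⟩ : ∃ z ∈ Metric.ball x (ρ / 2), f z ≠ 0 := by
    by_contra! h
    have := hf.eqOn_zero_of_preconnected_of_eventuallyEq_zero hGc hx.1
      (Filter.eventually_of_mem (Metric.ball_mem_nhds x (half_pos hρ)) h)
    exact hy (this hyG)
  have hsub : Metric.ball z (ρ / 2) ⊆ G := by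
    refine (Metric.ball_subset_ball' ?_).trans hball
    have := Metric.mem_ball.1 hz
    linarith
  refine ⟨{x ∈ Metric.ball z (ρ / 2) | f x = 0}, ?_,
    AnalyticOnNhd.measure_zeros_ball μ (half_pos hρ)
      (fun w hw => (hf w (hsub hw)).restrictScalars) hfz⟩
  have hxz : x ∈ Metric.ball z (ρ / 2) := by rwa [Metric.mem_ball_comm]
  filter_upwards [mem_nhdsWithin_of_mem_nhds (Metric.isOpen_ball.mem_nhds hxz),
    self_mem_nhdsWithin] with w hw hw'
  exact ⟨hw, hw'.2⟩

end ZeroSet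

/-! ### Straightening the flow -/

section LocalFirstIntegrals
open scoped Topology ContDiff

variable {𝕜 : Type*} [RCLike 𝕜]
  {E : Type*} [NormedAddCommGroup E] [NormedSpace 𝕜 E] [NormedSpace ℝ E] [IsScalarTower ℝ 𝕜 E]
  {M : Type*} [NormedAddCommGroup M] [NormedSpace 𝕜 M] [NormedSpace ℝ M] [IsScalarTower ℝ 𝕜 M]

/-- If the total differential equation `dy = A(y) dt` is solvable for all initial values near `c`,
it has an analytic local flow on a full neighbourhood of `(c, 0)`: the given solutions may exist on
domains of any size, but the equation extends by the identity theorem. -/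
theorem AnalyticAt.exists_local_flow [CompleteSpace E] [CompleteSpace M] {A : E → M →L[𝕜] E} {c : E}
    (hA : AnalyticAt 𝕜 A c)
    (hsolv : ∀ᶠ x in 𝓝 c, ∃ y : M → E, y 0 = x ∧ ∀ᶠ t in 𝓝 0, HasFDerivAt y (A (y t)) t) :
    ∃ φ : E × M → E, AnalyticAt 𝕜 φ (c, 0) ∧ (∀ᶠ x in 𝓝 c, φ (x, 0) = x) ∧
      ∀ᶠ p : E × M in 𝓝 (c, 0), HasFDerivAt (fun t => φ (p.1, t)) (A (φ p)) p.2 := by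
  obtain ⟨φ, hφ, hφy⟩ := hA.exists_analyticAt_flow
  have hφ0 : ∀ᶠ x in 𝓝 c, φ (x, 0) = x := by
    filter_upwards [hsolv, hφy] with x ⟨y, hy0, hy⟩ hx
    rw [← (hx y hy0 hy).self_of_nhds, hy0]
  refine ⟨φ, hφ, hφ0, ?_⟩
  have hAφ : ∀ᶠ p in 𝓝 ((c, 0) : E × M), AnalyticAt 𝕜 A (φ p) := by
    refine hφ.continuousAt.eventually ?_
    rw [hφ0.self_of_nhds]
    exact hA.eventually_analyticAt
  have hx : ∀ᶠ p in 𝓝 ((c, 0) : E × M), (∃ y : M → E, y 0 = p.1 ∧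
      ∀ᶠ t in 𝓝 0, HasFDerivAt y (A (y t)) t) ∧ ∀ y : M → E, y 0 = p.1 →
      (∀ᶠ t in 𝓝 0, HasFDerivAt y (A (y t)) t) → ∀ᶠ t in 𝓝 0, y t = φ (p.1, t) :=
    (continuous_fst.tendsto ((c, 0) : E × M)).eventually (hsolv.and hφy)
  obtain ⟨ε, hε, h⟩ := Metric.eventually_nhds_iff.1 ((hφ.eventually_analyticAt.and hAφ).and hx)
  filter_upwards [Metric.ball_mem_nhds ((c, 0) : E × M) hε] with p hp
  obtain ⟨x, t⟩ := p
  have hxc : dist x c < ε := (le_max_left _ _).trans_lt (Metric.mem_ball.1 hp)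
  have htc : dist t 0 < ε := (le_max_right _ _).trans_lt (Metric.mem_ball.1 hp)
  have hmem : ∀ s ∈ Metric.ball (0 : M) ε, dist ((x, s) : E × M) (c, 0) < ε :=
    fun s hs => max_lt hxc hs
  have hφx : AnalyticOnNhd 𝕜 (fun s => φ (x, s)) (Metric.ball 0 ε) := fun s hs =>
    AnalyticAt.fun_comp (g := φ) (f := fun s => (x, s)) (h (hmem s hs)).1.1
      (analyticAt_const.prod analyticAt_id)
  have hAx : AnalyticOnNhd 𝕜 (fun s => A (φ (x, s))) (Metric.ball 0 ε) := fun s hs =>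
    AnalyticAt.fun_comp (g := A) (f := fun s => φ (x, s)) (h (hmem s hs)).1.2 (hφx s hs)
  have heq : Set.EqOn (fderiv 𝕜 fun s => φ (x, s)) (fun s => A (φ (x, s))) (Metric.ball 0 ε) := by
    refine hφx.fderiv.eqOn_of_preconnected_of_eventuallyEq hAx (convex_ball _ _).isPreconnected
      (Metric.mem_ball_self hε) ?_
    obtain ⟨⟨y, hy0, hy⟩, hyφ⟩ := (h (hmem 0 (Metric.mem_ball_self hε))).2
    have hyx : y =ᶠ[𝓝 0] fun s => φ (x, s) := hyφ y hy0 hy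
    filter_upwards [hyx.eventuallyEq_nhds, hy] with s hs hs'
    rw [← hs.fderiv_eq, hs'.fderiv, hs.self_of_nhds]
  have htb : t ∈ Metric.ball (0 : M) ε := htc
  have := (hφx t htb).differentiableAt.hasFDerivAt
  rwa [heq htb] at this

/-- Straightening the local flow along a subspace `W` transversal to the range of `A c` gives
analytic functions, constant along the flow, with independent differentials. -/
theorem AnalyticAt.exists_transversal_integrals [FiniteDimensional 𝕜 E] [FiniteDimensional 𝕜 M]
    {A : E → M →L[𝕜] E} {c : E} (hA : AnalyticAt 𝕜 A c)
    (hsolv : ∀ᶠ x in 𝓝 c, ∃ y : M → E, y 0 = x ∧ ∀ᶠ t in 𝓝 0, HasFDerivAt y (A (y t)) t)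
    {V : Submodule 𝕜 M} {W : Submodule 𝕜 E} (hV : IsCompl V (LinearMap.ker (A c).toLinearMap))
    (hW : IsCompl (LinearMap.range (A c).toLinearMap) W) :
    ∃ F : E → W, ∀ᶠ x in 𝓝 c, AnalyticAt 𝕜 F x ∧ Function.Surjective (fderiv 𝕜 F x) ∧
      (∀ v : V, fderiv 𝕜 F x (A x v) = 0) ∧ ∀ v : V, A x v = 0 → v = 0 := by
  have := FiniteDimensional.complete 𝕜 E
  have := FiniteDimensional.complete 𝕜 M
  obtain ⟨φ, hφ, hφ0, hφA⟩ := hA.exists_local_flow hsolv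
  let σ : V × W → E × M := fun p => (c + p.2, p.1)
  have hσ0 : σ 0 = (c, 0) := by simp [σ]
  have hσ : ∀ p, AnalyticAt 𝕜 σ p := fun p =>
    (analyticAt_const.fun_add ((W.subtypeL.analyticAt _).comp analyticAt_snd)).prod
      ((V.subtypeL.analyticAt _).comp analyticAt_fst)
  let Ψ : V × W → E := fun p => φ (σ p)
  have hΨ : AnalyticAt 𝕜 Ψ 0 := AnalyticAt.fun_comp (g := φ) (by rwa [hσ0]) (hσ 0)
  have hΨc : Ψ 0 = c := by
    have := hφ0.self_of_nhds
    simpa [Ψ, hσ0] using this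
  -- The derivative of `Ψ` along the flow.
  have hΨV : ∀ᶠ p in 𝓝 (0 : V × W), ∀ v : V, fderiv 𝕜 Ψ p (v, 0) = A (Ψ p) v := by
    have h1 : ∀ᶠ p in 𝓝 (0 : V × W), HasFDerivAt (fun t => φ ((σ p).1, t)) (A (φ (σ p))) (σ p).2 := by
      refine (hσ 0).continuousAt.tendsto.eventually (p := fun q : E × M =>
        HasFDerivAt (fun t => φ (q.1, t)) (A (φ q)) q.2) ?_
      rwa [hσ0]
    filter_upwards [h1, hΨ.eventually_analyticAt] with p hp hpa v
    have h2 : HasFDerivAt (fun τ : V => Ψ (τ, p.2)) ((A (Ψ p)).comp V.subtypeL) p.1 :=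
      HasFDerivAt.comp (g := fun t => φ ((σ p).1, t)) (f := fun τ : V => (τ : M)) p.1 hp
        V.subtypeL.hasFDerivAt
    have h3 : HasFDerivAt (fun τ : V => Ψ (τ, p.2)) ((fderiv 𝕜 Ψ p).comp (.inl 𝕜 V W)) p.1 :=
      HasFDerivAt.comp (g := Ψ) (f := fun τ : V => (τ, p.2)) p.1
        hpa.differentiableAt.hasFDerivAt (hasFDerivAt_prodMk_left p.1 p.2)
    exact DFunLike.congr_fun (h3.unique h2) v
  have hΨW : ∀ w : W, fderiv 𝕜 Ψ 0 (0, w) = w := by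
    intro w
    have h2 : HasFDerivAt (fun w : W => Ψ (0, w)) W.subtypeL 0 := by
      have h4 : HasFDerivAt (fun w : W => c + (w : E)) W.subtypeL 0 :=
        W.subtypeL.hasFDerivAt.const_add c
      refine h4.congr_of_eventuallyEq ?_
      have h5 : Filter.Tendsto (fun w : W => c + (w : E)) (𝓝 0) (𝓝 c) := by
        have : Continuous fun w : W => c + (w : E) := by fun_prop
        simpa using this.tendsto 0
      exact h5.eventually hφ0
    have h3 : HasFDerivAt (fun w : W => Ψ (0, w)) ((fderiv 𝕜 Ψ 0).comp (.inr 𝕜 V W)) 0 :=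
      HasFDerivAt.comp (g := Ψ) (f := fun w : W => ((0 : V), w)) 0
        hΨ.differentiableAt.hasFDerivAt (hasFDerivAt_prodMk_right 0 0)
    exact DFunLike.congr_fun (h3.unique h2) w
  let D : (V × W) ≃L[𝕜] E :=
    (((((A c).toLinearMap.kerComplementEquivRange hV)).prodCongr (LinearEquiv.refl 𝕜 W)).trans
      (Submodule.prodEquivOfIsCompl _ W hW)).toContinuousLinearEquiv
  have hD : HasFDerivAt Ψ (D : V × W →L[𝕜] E) 0 := by
    refine hΨ.differentiableAt.hasFDerivAt.congr_fderiv ?_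
    refine ContinuousLinearMap.ext fun p => ?_
    have h1 : fderiv 𝕜 Ψ 0 p = fderiv 𝕜 Ψ 0 (p.1, 0) + fderiv 𝕜 Ψ 0 (0, p.2) := by
      rw [← map_add]; simp
    rw [h1, hΨW, hΨV.self_of_nhds, hΨc]
    simp [D]
  have hω : (ω : WithTop ℕ∞) ≠ 0 := by simp
  let R := hΨ.contDiffAt.toOpenPartialHomeomorph Ψ (n := ω) hD hω
  have hR0 : (0 : V × W) ∈ R.source := ContDiffAt.mem_toOpenPartialHomeomorph_source _ hD hω
  have hRc : R 0 = c := hΨc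
  have hct : c ∈ R.target := by rw [← hRc]; exact R.map_source hR0
  have hinv : AnalyticAt 𝕜 R.symm c := by
    rw [← hΨc]
    exact (ContDiffAt.to_localInverse hΨ.contDiffAt hD hω).analyticAt
  have hsymm : R.symm c = 0 := by rw [← hRc, R.left_inv hR0]
  have hgood : ∀ᶠ x in 𝓝 c, AnalyticAt 𝕜 Ψ (R.symm x) ∧
      ∀ v : V, fderiv 𝕜 Ψ (R.symm x) (v, 0) = A (Ψ (R.symm x)) v := by
    refine hinv.continuousAt.tendsto.eventually (p := fun q => AnalyticAt 𝕜 Ψ q ∧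
      ∀ v : V, fderiv 𝕜 Ψ q (v, 0) = A (Ψ q) v) ?_
    rw [hsymm]
    exact hΨ.eventually_analyticAt.and hΨV
  refine ⟨fun x => (R.symm x).2, ?_⟩
  filter_upwards [R.open_target.mem_nhds hct, hinv.eventually_analyticAt, hgood]
    with x hxt hxa ⟨hΨx, hVx⟩
  have hRx : Ψ (R.symm x) = x := R.right_inv hxt
  have hid : (fderiv 𝕜 R.symm x).comp (fderiv 𝕜 Ψ (R.symm x)) = ContinuousLinearMap.id 𝕜 _ := by
    have h1 : HasFDerivAt (fun p => R.symm (Ψ p))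
        ((fderiv 𝕜 R.symm x).comp (fderiv 𝕜 Ψ (R.symm x))) (R.symm x) := by
      refine HasFDerivAt.comp (g := R.symm) (f := Ψ) (R.symm x) ?_ hΨx.differentiableAt.hasFDerivAt
      rw [hRx]
      exact hxa.differentiableAt.hasFDerivAt
    refine h1.unique ((hasFDerivAt_id (R.symm x)).congr_of_eventuallyEq ?_)
    filter_upwards [R.open_source.mem_nhds (R.map_target hxt)] with p hp
    exact R.left_inv hp
  have hF : fderiv 𝕜 (fun x => (R.symm x).2) x
      = (ContinuousLinearMap.snd 𝕜 V W).comp (fderiv 𝕜 R.symm x) :=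
    hxa.differentiableAt.hasFDerivAt.snd.fderiv
  have hid' : ∀ q, fderiv 𝕜 R.symm x (fderiv 𝕜 Ψ (R.symm x) q) = q := DFunLike.congr_fun hid
  rw [hRx] at hVx
  refine ⟨analyticAt_snd.comp hxa, fun w => ⟨fderiv 𝕜 Ψ (R.symm x) (0, w), ?_⟩, fun v => ?_,
    fun v hv => ?_⟩
  · rw [hF, ContinuousLinearMap.comp_apply, hid']; rfl
  · rw [hF, ContinuousLinearMap.comp_apply, ← hVx, hid']; rfl
  · have h1 := hid' (v, 0)
    rw [hVx, hv, map_zero] at h1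
    exact (congrArg Prod.fst h1).symm

end LocalFirstIntegrals

/-! ### First integrals of autonomous systems -/

section AutonomousSystems
open Set Topology

namespace TotalDiff

variable {𝕜 : Type*} [RCLike 𝕜] {m n : ℕ}

/-- Autonomous first integrals expressed without the variable `t`. -/
theorem isAutonomousFirstIntegralOn_iff {X : (Fin n → 𝕜) → Matrix (Fin n) (Fin m) 𝕜}
    {U : Set (Fin n → 𝕜)} {F : (Fin n → 𝕜) → 𝕜} :
    IsAutonomousFirstIntegralOn X U F ↔
      AnalyticOnNhd 𝕜 F U ∧ ∀ x ∈ U, ∀ v, fderiv 𝕜 F x ((X x).mulVec v) = 0 := by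
  have hfd : ∀ x, AnalyticAt 𝕜 F x → ∀ t v w, fderiv 𝕜 (fun p : (Fin m → 𝕜) × (Fin n → 𝕜) => F p.2)
      (t, x) (v, w) = fderiv 𝕜 F x w := by
    intro x hx t v w
    have h : HasFDerivAt (fun p : (Fin m → 𝕜) × (Fin n → 𝕜) => F p.2)
        ((fderiv 𝕜 F x).comp (.snd 𝕜 _ _)) (t, x) :=
      HasFDerivAt.comp (g := F) (t, x) hx.differentiableAt.hasFDerivAt hasFDerivAt_snd
    rw [h.fderiv]; rfl
  constructor
  · rintro ⟨ha, hd⟩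
    have ha' : AnalyticOnNhd 𝕜 F U := fun x hx =>
      AnalyticAt.fun_comp (g := fun p : (Fin m → 𝕜) × (Fin n → 𝕜) => F p.2)
        (f := fun x => ((0 : Fin m → 𝕜), x)) (ha (0, x) ⟨mem_univ _, hx⟩)
        (analyticAt_const.prod analyticAt_id)
    refine ⟨ha', fun x hx v => ?_⟩
    rw [← hfd x (ha' x hx) 0 v]
    exact hd (0, x) ⟨mem_univ _, hx⟩ v
  · rintro ⟨ha, hd⟩
    refine ⟨fun p hp => (ha p.2 hp.2).fun_comp analyticAt_snd, fun p hp v => ?_⟩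
    exact (hfd p.2 (ha p.2 hp.2) p.1 v _).trans (hd p.2 hp.2 v)

theorem jacobiMatrix_mulVec {k : ℕ} (F : Fin k → (Fin n → 𝕜) → 𝕜) (x v : Fin n → 𝕜) (l : Fin k) :
    (jacobiMatrix F x).mulVec v l = fderiv 𝕜 (F l) x v := by
  conv_rhs => rw [pi_eq_sum_univ' v]
  simp only [Matrix.mulVec, dotProduct, jacobiMatrix, Matrix.of_apply, map_sum, map_smul,
    smul_eq_mul]
  exact Finset.sum_congr rfl fun i _ => mul_comm _ _

/-- The right-hand side of the system as a map into the continuous linear maps is analytic. -/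
theorem analyticAt_toLin' {X : (Fin n → 𝕜) → Matrix (Fin n) (Fin m) 𝕜} {x : Fin n → 𝕜}
    (hX : ∀ i j, AnalyticAt 𝕜 (fun x => X x i j) x) :
    AnalyticAt 𝕜 (fun x => LinearMap.toContinuousLinearMap (Matrix.toLin' (X x))) x := by
  let Λ : (Fin n → Fin m → 𝕜) →ₗ[𝕜] ((Fin m → 𝕜) →L[𝕜] (Fin n → 𝕜)) :=
    LinearMap.toContinuousLinearMap.toLinearMap ∘ₗ Matrix.toLin'.toLinearMap ∘ₗ
      (Matrix.ofLinearEquiv 𝕜).toLinearMap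
  exact AnalyticAt.fun_comp (g := Λ.toContinuousLinearMap) (f := fun x i j => X x i j)
    (ContinuousLinearMap.analyticAt _ _) (AnalyticAt.pi fun i => AnalyticAt.pi fun j => hX i j)

/-- A completely solvable system whose matrix has constant rank `r` near `c` has `n - r` first
integrals near `c` whose differentials are linearly independent at every point. -/
theorem exists_local_autonomousFirstIntegrals {G : Set (Fin n → 𝕜)}
    {X : (Fin n → 𝕜) → Matrix (Fin n) (Fin m) 𝕜} (hGo : IsOpen G)
    (hX : ∀ i j, AnalyticOnNhd 𝕜 (fun x => X x i j) G)
    (hsolv : CompletelySolvable (autonomous X) (univ ×ˢ G)) {G' : Set (Fin n → 𝕜)} (hG' : G' ⊆ G)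
    (hG'o : IsOpen G') {r : ℕ} (hr : ∀ x ∈ G', (X x).rank = r) {c : Fin n → 𝕜} (hc : c ∈ G') :
    ∃ U ⊆ G', IsDomainSet U ∧ c ∈ U ∧ ∃ F : Fin (n - r) → (Fin n → 𝕜) → 𝕜,
      (∀ l, IsAutonomousFirstIntegralOn X U (F l)) ∧
      ∀ x ∈ U, (jacobiMatrix F x).rank = n - r := by
  let A : (Fin n → 𝕜) → (Fin m → 𝕜) →L[𝕜] (Fin n → 𝕜) := fun x =>
    LinearMap.toContinuousLinearMap (Matrix.toLin' (X x))
  have hAX : ∀ x v, A x v = (X x).mulVec v := fun x v => Matrix.toLin'_apply _ _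
  have hrank : ∀ x, Module.finrank 𝕜 (LinearMap.range (A x).toLinearMap) = (X x).rank := fun x => rfl
  have hA : AnalyticAt 𝕜 A c := analyticAt_toLin' fun i j => hX i j c (hG' hc)
  have hloc : ∀ᶠ x in 𝓝 c, ∃ y : (Fin m → 𝕜) → (Fin n → 𝕜), y 0 = x ∧
      ∀ᶠ t in 𝓝 0, HasFDerivAt y (A (y t)) t := by
    filter_upwards [hGo.mem_nhds (hG' hc)] with x hx
    obtain ⟨T, y, h0, hy, hyx⟩ := (hsolv 0 x ⟨mem_univ _, hx⟩).1
    refine ⟨y, hyx, ?_⟩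
    filter_upwards [hy.1.1.mem_nhds h0] with t ht
    exact (hy.2 t ht).2
  obtain ⟨V, hV⟩ := (LinearMap.ker (A c).toLinearMap).exists_isCompl
  obtain ⟨W, hW⟩ := (LinearMap.range (A c).toLinearMap).exists_isCompl
  have hVr : Module.finrank 𝕜 V = r := by
    rw [((A c).toLinearMap.kerComplementEquivRange hV.symm).finrank_eq, hrank, hr c hc]
  have hWr : Module.finrank 𝕜 W = n - r := by
    have h := Submodule.finrank_add_eq_of_isCompl hW
    rw [hrank, hr c hc, Module.finrank_fin_fun] at h
    omega
  obtain ⟨F, hF⟩ := hA.exists_transversal_integrals hloc hV.symm hW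
  let e : W ≃L[𝕜] (Fin (n - r) → 𝕜) := ContinuousLinearEquiv.ofFinrankEq (by simp [hWr])
  obtain ⟨ε, hε, hball⟩ := Metric.eventually_nhds_iff.1 (hF.and (hG'o.mem_nhds hc))
  have hderiv : ∀ x ∈ Metric.ball c ε, ∀ l v,
      fderiv 𝕜 (fun x => e (F x) l) x v = e (fderiv 𝕜 F x v) l := by
    intro x hx l v
    have h1 : HasFDerivAt (fun x => e (F x)) ((e : W →L[𝕜] _).comp (fderiv 𝕜 F x)) x :=
      HasFDerivAt.comp x (e : W →L[𝕜] (Fin (n - r) → 𝕜)).hasFDerivAt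
        (hball hx).1.1.differentiableAt.hasFDerivAt
    rw [((hasFDerivAt_pi'.1 h1) l).fderiv]
    rfl
  refine ⟨Metric.ball c ε, fun x hx => (hball hx).2, ⟨Metric.isOpen_ball,
    ⟨c, Metric.mem_ball_self hε⟩, (convex_ball c ε).isPreconnected⟩, Metric.mem_ball_self hε,
    fun l x => e (F x) l, fun l => isAutonomousFirstIntegralOn_iff.2 ⟨fun x hx => ?_, ?_⟩, ?_⟩
  · exact ((ContinuousLinearMap.proj (R := 𝕜) l).comp (e : W →L[𝕜] (Fin (n - r) → 𝕜))).analyticAt _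
      |>.comp (hball hx).1.1
  · intro x hx v
    obtain ⟨⟨_, _, hFV, hinj⟩, hxG⟩ := hball hx
    -- By constancy of the rank, the range of `A x` is already the image of `V`.
    have hrange : V.map (A x).toLinearMap = LinearMap.range (A x).toLinearMap := by
      refine Submodule.eq_of_le_of_finrank_eq LinearMap.map_le_range ?_
      rw [hrank, hr x hxG, ← hVr]
      have hker : LinearMap.ker ((A x).toLinearMap.comp V.subtype) = ⊥ :=
        LinearMap.ker_eq_bot'.2 hinj
      have h2 := LinearMap.finrank_range_of_inj (LinearMap.ker_eq_bot.1 hker)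
      rwa [LinearMap.range_comp, Submodule.range_subtype] at h2
    have hmem : A x v ∈ V.map (A x).toLinearMap := by
      rw [hrange]; exact ⟨v, rfl⟩
    obtain ⟨v', hv', hvv'⟩ := hmem
    rw [hderiv x hx, ← hAX, ← hvv']
    have h3 : fderiv 𝕜 F x (A x v') = 0 := hFV ⟨v', hv'⟩
    simp only [ContinuousLinearMap.coe_coe]
    rw [h3, map_zero, Pi.zero_apply]
  · intro x hx
    have hsurj : Function.Surjective (jacobiMatrix (fun l x => e (F x) l) x).mulVecLin := by
      intro z
      obtain ⟨v, hv⟩ := (hball hx).1.2.1 (e.symm z)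
      refine ⟨v, funext fun l => ?_⟩
      rw [Matrix.mulVecLin_apply, jacobiMatrix_mulVec, hderiv x hx, hv, e.apply_symm_apply]
    rw [Matrix.rank, LinearMap.range_eq_top.2 hsurj, finrank_top, Module.finrank_fin_fun]

/-- A property holding almost everywhere on a nonempty open set holds somewhere on it. -/
theorem AlmostEverywhereOn.exists {U : Set (Fin n → 𝕜)} {P : (Fin n → 𝕜) → Prop}
    (h : AlmostEverywhereOn U P) (hU : IsOpen U) (hne : U.Nonempty) : ∃ x ∈ U, P x := by
  by_contra! hP
  have h1 : {x ∈ U | ¬ P x} = U := by exact Set.sep_eq_self_iff_mem_true.2 hP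
  unfold AlmostEverywhereOn at h
  rw [h1] at h
  exact (hU.measure_pos _ hne).ne' h

theorem AlmostEverywhereOn.mono {U V : Set (Fin n → 𝕜)} {P : (Fin n → 𝕜) → Prop}
    (h : AlmostEverywhereOn U P) (hVU : V ⊆ U) : AlmostEverywhereOn V P :=
  measure_mono_null (t := {x ∈ U | ¬ P x}) (fun _ hx => ⟨hVU hx.1, hx.2⟩) h

theorem rank_jacobiMatrix_add_rank_le {X : (Fin n → 𝕜) → Matrix (Fin n) (Fin m) 𝕜}
    {U : Set (Fin n → 𝕜)} {k : ℕ} {F : Fin k → (Fin n → 𝕜) → 𝕜}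
    (hF : ∀ l, IsAutonomousFirstIntegralOn X U (F l)) {x : Fin n → 𝕜} (hx : x ∈ U) :
    (jacobiMatrix F x).rank + (X x).rank ≤ n := by
  have h : jacobiMatrix F x * X x = 0 := by
    refine Matrix.toLin'.injective (LinearMap.ext fun v => funext fun l => ?_)
    rw [Matrix.toLin'_apply, ← Matrix.mulVec_mulVec, jacobiMatrix_mulVec,
      (isAutonomousFirstIntegralOn_iff.1 (hF l)).2 x hx v]
    simp
  simpa using Matrix.rank_add_rank_le_card_of_mul_eq_zero h

/-- If the rank is full almost everywhere, the differential of a first integral vanishes on a dense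
set, hence everywhere. -/
theorem IsAutonomousFirstIntegralOn.exists_eq_const {X : (Fin n → 𝕜) → Matrix (Fin n) (Fin m) 𝕜}
    {U : Set (Fin n → 𝕜)} (hU : IsDomainSet U) (hrank : AlmostEverywhereOn U fun x => (X x).rank = n)
    {F : (Fin n → 𝕜) → 𝕜} (hF : IsAutonomousFirstIntegralOn X U F) : ∃ c, ∀ x ∈ U, F x = c := by
  obtain ⟨ha, hd⟩ := isAutonomousFirstIntegralOn_iff.1 hF
  have hzero : EqOn (fderiv 𝕜 F) 0 U := by
    intro x hx
    by_contra hne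
    have hopen : IsOpen (U ∩ fderiv 𝕜 F ⁻¹' {0}ᶜ) :=
      ha.fderiv.continuousOn.isOpen_inter_preimage hU.1 isOpen_compl_singleton
    obtain ⟨z, hz, hzr⟩ := (hrank.mono inter_subset_left).exists hopen ⟨x, hx, hne⟩
    refine hz.2 (show fderiv 𝕜 F z = 0 from ContinuousLinearMap.ext fun w => ?_)
    have hsurj : LinearMap.range (X z).mulVecLin = ⊤ :=
      Submodule.eq_top_of_finrank_eq (by rw [Module.finrank_fin_fun]; exact hzr)
    obtain ⟨v, hv⟩ := LinearMap.range_eq_top.1 hsurj w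
    rw [← hv]
    exact hd z hz.1 v
  obtain ⟨x₀, hx₀⟩ := hU.2.1
  exact ⟨F x₀, fun x hx => hU.1.is_const_of_fderiv_eq_zero hU.2.2
    (fun z hz => (ha z hz).differentiableAt.differentiableWithinAt) hzero hx hx₀⟩

/-- The rank of an analytic matrix on a domain is full almost everywhere or nowhere: if `X y` has
the right inverse `B`, then `det (X x * B)` does not vanish identically. -/
theorem almostEverywhereOn_rank_eq {G : Set (Fin n → 𝕜)} (hG : IsDomainSet G)
    {X : (Fin n → 𝕜) → Matrix (Fin n) (Fin m) 𝕜}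
    (hX : ∀ i j, AnalyticOnNhd 𝕜 (fun x => X x i j) G) {y : Fin n → 𝕜} (hy : y ∈ G)
    (hyr : (X y).rank = n) : AlmostEverywhereOn G fun x => (X x).rank = n := by
  have hsurj : LinearMap.range (Matrix.toLin' (X y)) = ⊤ :=
    Submodule.eq_top_of_finrank_eq (by rw [Module.finrank_fin_fun]; exact hyr)
  obtain ⟨g, hg⟩ := (Matrix.toLin' (X y)).exists_rightInverse_of_surjective hsurj
  let B : Matrix (Fin m) (Fin n) 𝕜 := LinearMap.toMatrix' g
  have hB : X y * B = 1 := by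
    refine Matrix.toLin'.injective ?_
    rw [Matrix.toLin'_mul, Matrix.toLin'_toMatrix', hg, Matrix.toLin'_one]
  have hdet : AnalyticOnNhd 𝕜 (fun x => (X x * B).det) G := by
    intro x hx
    simp only [Matrix.det_apply', Matrix.mul_apply]
    refine Finset.analyticAt_fun_sum _ fun σ _ => ?_
    refine analyticAt_const.fun_mul (Finset.analyticAt_fun_prod _ fun i _ => ?_)
    exact Finset.analyticAt_fun_sum _ fun j _ => (hX _ _ x hx).fun_mul analyticAt_const
  refine measure_mono_null ?_ (hdet.measure_zeros Measure.addHaar hG.1 hG.2.2 hy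
    (by simp [hB]))
  rintro x ⟨hx, hxr⟩
  refine ⟨hx, ?_⟩
  by_contra hne
  refine hxr (le_antisymm (by simpa using (X x).rank_le_card_height) ?_)
  have h1 : (X x * B).rank = n := by
    simpa using Matrix.rank_of_isUnit _ ((Matrix.isUnit_iff_isUnit_det _).2 (isUnit_iff_ne_zero.2 hne))
  exact h1.symm.le.trans (Matrix.rank_mul_le_left _ _)

theorem eventually_rank_le {X : (Fin n → 𝕜) → Matrix (Fin n) (Fin m) 𝕜} {c : Fin n → 𝕜}
    (hX : ∀ i j, AnalyticAt 𝕜 (fun x => X x i j) c) : ∀ᶠ x in 𝓝 c, (X c).rank ≤ (X x).rank := by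
  have h (x : Fin n → 𝕜) : (((X x).rank : ℕ) : Cardinal) = (Matrix.toLin' (X x)).rank :=
    Module.finrank_eq_rank 𝕜 _
  filter_upwards [(analyticAt_toLin' hX).continuousAt.eventually
    ((isOpen_setOfPred_nat_le_rank (X c).rank).mem_nhds (h c).le)] with x hx
  exact Nat.cast_le.1 (hx.trans (h x).symm.le)

end TotalDiff

end AutonomousSystems

theorem theorem1p6 {𝕜 : Type*} [RCLike 𝕜] {m n : ℕ}
    (G : Set (Fin n → 𝕜)) (hG : TotalDiff.IsDomainSet G)
    (X : (Fin n → 𝕜) → Matrix (Fin n) (Fin m) 𝕜)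
    (hX : ∀ i j, AnalyticOnNhd 𝕜 (fun x => X x i j) G)
    (hsolv : TotalDiff.CompletelySolvable (TotalDiff.autonomous X) (Set.univ ×ˢ G)) :
    (∀ G' ⊆ G, TotalDiff.IsDomainSet G' → ∀ r : ℕ, (∀ x ∈ G', (X x).rank = r) →
      (∀ x₀ ∈ G', ∃ U ⊆ G', TotalDiff.IsDomainSet U ∧ x₀ ∈ U ∧
        ∃ F : Fin (n - r) → (Fin n → 𝕜) → 𝕜,
          (∀ l, TotalDiff.IsAutonomousFirstIntegralOn X U (F l)) ∧
          TotalDiff.FunctionallyIndependentOn U F) ∧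
      (∀ U ⊆ G', TotalDiff.IsDomainSet U → ∀ (k : ℕ) (F : Fin k → (Fin n → 𝕜) → 𝕜),
        (∀ l, TotalDiff.IsAutonomousFirstIntegralOn X U (F l)) →
        TotalDiff.FunctionallyIndependentOn U F → k ≤ n - r)) ∧
    ((¬ ∃ U ⊆ G, TotalDiff.IsDomainSet U ∧ ∃ F : (Fin n → 𝕜) → 𝕜,
        TotalDiff.IsAutonomousFirstIntegralOn X U F ∧ ¬ ∃ c : 𝕜, ∀ x ∈ U, F x = c) ↔
      TotalDiff.AlmostEverywhereOn G fun x => (X x).rank = n) := by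
  refine ⟨fun G' hG' hG'd r hr => ⟨fun x₀ hx₀ => ?_, fun U hU hUd k F hF hind => ?_⟩, ?_, ?_⟩
  · obtain ⟨U, hUG, hU, hxU, F, hF, hrank⟩ :=
      TotalDiff.exists_local_autonomousFirstIntegrals hG.1 hX hsolv hG' hG'd.1 hr hx₀
    refine ⟨U, hUG, hU, hxU, F, hF, measure_mono_null ?_ measure_empty⟩
    exact fun x hx => hx.2 (hrank x hx.1)
  · obtain ⟨x, hx, hxr⟩ := TotalDiff.AlmostEverywhereOn.exists hind hUd.1 hUd.2.1
    have h := TotalDiff.rank_jacobiMatrix_add_rank_le hF hx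
    rw [hxr, hr x (hU hx)] at h
    omega
  · intro hno
    by_contra hae
    -- Otherwise the rank is less than `n` everywhere, and near a point where it is maximal it is
    -- constant, so that nonconstant first integrals exist there.
    have hlt : ∀ x ∈ G, (X x).rank < n := fun x hx =>
      lt_of_le_of_ne (by simpa using (X x).rank_le_card_height)
        fun h => hae (TotalDiff.almostEverywhereOn_rank_eq hG hX hx h)
    obtain ⟨c, hc, hmax⟩ : ∃ c ∈ G, ∀ x ∈ G, (X x).rank ≤ (X c).rank := by
      have hfin : ((fun x => (X x).rank) '' G).Finite :=
        (Set.finite_lt_nat n).subset (Set.image_subset_iff.2 hlt)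
      obtain ⟨_, ⟨c, hc, rfl⟩, hmax⟩ := Set.exists_max_image _ id hfin (hG.2.1.image _)
      exact ⟨c, hc, fun x hx => hmax _ ⟨x, hx, rfl⟩⟩
    obtain ⟨ε, hε, hball⟩ := Metric.eventually_nhds_iff.1
      ((TotalDiff.eventually_rank_le fun i j => hX i j c hc).and (hG.1.mem_nhds hc))
    obtain ⟨U, hUG, hU, hcU, F, hF, hrank⟩ := TotalDiff.exists_local_autonomousFirstIntegrals
      hG.1 hX hsolv (G' := Metric.ball c ε) (fun x hx => (hball hx).2) Metric.isOpen_ball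
      (r := (X c).rank) (fun x hx => le_antisymm (hmax x (hball hx).2) (hball hx).1)
      (Metric.mem_ball_self hε)
    have hpos : 0 < n - (X c).rank := Nat.sub_pos_of_lt (hlt c hc)
    refine hno ⟨U, fun x hx => (hball (hUG hx)).2, hU, F ⟨0, hpos⟩, hF _, ?_⟩
    rintro ⟨a, ha⟩
    have hd0 : fderiv 𝕜 (F ⟨0, hpos⟩) c = 0 := by
      have h : F ⟨0, hpos⟩ =ᶠ[nhds c] fun _ => a :=
        Filter.eventually_of_mem (hU.1.mem_nhds hcU) ha
      rw [h.fderiv_eq, fderiv_fun_const]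
      rfl
    have hsurj : LinearMap.range (TotalDiff.jacobiMatrix F c).mulVecLin = ⊤ :=
      Submodule.eq_top_of_finrank_eq (by rw [Module.finrank_fin_fun]; exact hrank c hcU)
    obtain ⟨v, hv⟩ := LinearMap.range_eq_top.1 hsurj fun _ => 1
    have h1 := congrFun hv ⟨0, hpos⟩
    rw [Matrix.mulVecLin_apply, TotalDiff.jacobiMatrix_mulVec, hd0] at h1
    simp at h1
  · rintro hae ⟨U, hUG, hU, F, hF, hne⟩
    exact hne (hF.exists_eq_const hU (hae.mono hUG))
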